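/- Let $n,m$ be non-negative integers. For a complex matrix $X$ let $X^\dagger$ be its conjugate transpose and $X^\#$ its entrywise complex conjugate; put $J_k=\operatorname{diag}(I_k,-I_k)$, and $X^\flat=J_rX^\dagger J_k$ for $X\in\mathbb{C}^{2k\times 2r}$; for $U,V\in\mathbb{C}^{k\times r}$ put $\Delta(U,V)=\begin{bmatrix}U&V\\V^\#&U^\#\end{bmatrix}$. Let $S\in\mathbb{C}^{m\times m}$ be unitary (for instance $S=I_m$), let $C_-,C_+\in\mathbb{C}^{m\times n}$, and let $\Omega_-,\Omega_+\in\mathbb{C}^{n\times n}$ be such that $\Omega=\Delta(\Omega_-,\Omega_+)$ is Hermitian. Consider the linear quantum system with system matrices $$\mathcal{D}=\Delta(S,0),\quad \mathcal{C}=\Delta(C_-,C_+),\quad \mathcal{B}=-\mathcal{C}^\flat\mathcal{D},\quad \mathcal{A}=-\mathrm{i}J_n\Omega-\tfrac12\,\mathcal{C}^\flat\mathcal{C},$$ and its $2m\times 2m$ rational transfer matrix $G(s)=\mathcal{C}(sI-\mathcal{A})^{-1}\mathcal{B}+\mathcal{D}$. The Smith–McMillan form of a rational matrix $G(s)$ of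 normal rank $r$ is the pseudo-diagonal matrix $M(s)=\operatorname{diag}\{\alpha_1/\beta_1,\dots,\alpha_r/\beta_r,0,\dots,0\}$ with $M(s)=U(s)G(s)V(s)$ for some polynomial unimodular matrices $U,V$, where $\alpha_i,\beta_i\in\mathbb{C}[s]$ are monic, $\alpha_i$ and $\beta_i$ are coprime for each $i$, and $\alpha_i\mid\alpha_{i+1}$, $\beta_{i+1}\mid\beta_i$ for $1\le i<r$. A number $s_0\in\mathbb{C}$ is a pole of $G$ if it is a root of some $\beta_i$, and a transmission zero of $G$ if it is a root of some $\alpha_i$. Then, for every $s_0\in\mathbb{C}$, $s_0$ is a pole of $G(s)$ if and only if $-s_0^\ast$ is a transmission zero of $G(s)$. -/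

import Mathlib

open Polynomial Matrix

/-- The matrix `J_k = diag(I_k, -I_k)`. -/
def Jmat (k : ℕ) : Matrix (Fin k ⊕ Fin k) (Fin k ⊕ Fin k) ℂ :=
  Matrix.fromBlocks 1 0 0 (-1)

/-- The `♭`-adjoint `X^♭ = J_r X^† J_k` of a `2k × 2r` complex matrix. -/
noncomputable def flatAdj {k r : ℕ} (X : Matrix (Fin k ⊕ Fin k) (Fin r ⊕ Fin r) ℂ) :
    Matrix (Fin r ⊕ Fin r) (Fin k ⊕ Fin k) ℂ :=
  Jmat r * Xᴴ * Jmat k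

/-- The doubled-up matrix `Δ(U, V)` with rows `(U, V)` and `(V^#, U^#)`, where `#` is the
entrywise complex conjugate. -/
def doubledUp {k r : ℕ} (U V : Matrix (Fin k) (Fin r) ℂ) :
    Matrix (Fin k ⊕ Fin k) (Fin r ⊕ Fin r) ℂ :=
  Matrix.fromBlocks U V (V.map star) (U.map star)

/-- The parameters of a linear quantum system of `n` harmonic oscillators interacting with `m`
boson fields: the unitary scattering matrix `S`, the coupling matrices `C₋, C₊`, and the
Hamiltonian matrices `Ω₋, Ω₊`, with `Δ(Ω₋, Ω₊)` Hermitian. -/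
structure LinearQuantumSystem (n m : ℕ) where
  S : Matrix (Fin m) (Fin m) ℂ
  Cminus : Matrix (Fin m) (Fin n) ℂ
  Cplus : Matrix (Fin m) (Fin n) ℂ
  Ωminus : Matrix (Fin n) (Fin n) ℂ
  Ωplus : Matrix (Fin n) (Fin n) ℂ
  unitary_S : S ∈ Matrix.unitaryGroup (Fin m) ℂ
  hermitian_Ω : (doubledUp Ωminus Ωplus).IsHermitian

namespace LinearQuantumSystem

variable {n m : ℕ}

/-- `Ω = Δ(Ω₋, Ω₊)`. -/
def Ωmat (Q : LinearQuantumSystem n m) : Matrix (Fin n ⊕ Fin n) (Fin n ⊕ Fin n) ℂ :=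
  doubledUp Q.Ωminus Q.Ωplus

/-- `𝒟 = Δ(S, 0)`. -/
def Dmat (Q : LinearQuantumSystem n m) : Matrix (Fin m ⊕ Fin m) (Fin m ⊕ Fin m) ℂ :=
  doubledUp Q.S 0

/-- `𝒞 = Δ(C₋, C₊)`. -/
def Cmat (Q : LinearQuantumSystem n m) : Matrix (Fin m ⊕ Fin m) (Fin n ⊕ Fin n) ℂ :=
  doubledUp Q.Cminus Q.Cplus

/-- `ℬ = - 𝒞^♭ 𝒟`. -/
noncomputable def Bmat (Q : LinearQuantumSystem n m) :
    Matrix (Fin n ⊕ Fin n) (Fin m ⊕ Fin m) ℂ :=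
  -(flatAdj Q.Cmat * Q.Dmat)

/-- `𝒜 = - i J_n Ω - (1/2) 𝒞^♭ 𝒞`. -/
noncomputable def Amat (Q : LinearQuantumSystem n m) :
    Matrix (Fin n ⊕ Fin n) (Fin n ⊕ Fin n) ℂ :=
  -(Complex.I • (Jmat n * Q.Ωmat)) - (1 / 2 : ℂ) • (flatAdj Q.Cmat * Q.Cmat)

end LinearQuantumSystem

/-- The transfer matrix `G(s) = C (sI - A)⁻¹ B + D` of a state-space realization, as a matrix
of rational functions of `s`. (The matrix `sI - A` is always invertible over `ℂ(s)`.) -/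
noncomputable def stateSpaceTransfer {σ ι κ : Type} [Fintype σ] [DecidableEq σ]
    (A : Matrix σ σ ℂ) (B : Matrix σ κ ℂ) (C : Matrix ι σ ℂ) (D : Matrix ι κ ℂ) :
    Matrix ι κ (RatFunc ℂ) :=
  C.map RatFunc.C * (Matrix.scalar σ (RatFunc.X : RatFunc ℂ) - A.map RatFunc.C)⁻¹ *
    B.map RatFunc.C + D.map RatFunc.C

/-- The `2m × 2m` transfer matrix of a linear quantum system, the `m + m` rows and columns being
numbered in their usual order. -/
noncomputable def LinearQuantumSystem.transferMatrix {n m : ℕ} (Q : LinearQuantumSystem n m) :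
    Matrix (Fin (m + m)) (Fin (m + m)) (RatFunc ℂ) :=
  Matrix.reindex finSumFinEquiv finSumFinEquiv
    (stateSpaceTransfer Q.Amat Q.Bmat Q.Cmat Q.Dmat)

/-- The `p × q` pseudo-diagonal rational matrix `diag(α₁/β₁, …, α_r/β_r, 0, …, 0)`. -/
noncomputable def pseudoDiag (p q : ℕ) {r : ℕ} (α β : Fin r → ℂ[X]) :
    Matrix (Fin p) (Fin q) (RatFunc ℂ) :=
  Matrix.of fun i j =>
    if h : (i : ℕ) = (j : ℕ) ∧ (i : ℕ) < r then
      algebraMap ℂ[X] (RatFunc ℂ) (α ⟨i, h.2⟩) / algebraMap ℂ[X] (RatFunc ℂ) (β ⟨i, h.2⟩)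
    else 0

/-- `diag(α₁/β₁, …, α_r/β_r, 0, …, 0)` is the Smith–McMillan form of the rational matrix `G`.
The normal rank of `G` is its rank over the field of rational functions; the polynomial
unimodular matrices are the invertible matrices over `ℂ[s]`. -/
structure IsSmithMcMillanForm {p q : ℕ} (G : Matrix (Fin p) (Fin q) (RatFunc ℂ)) {r : ℕ}
    (α β : Fin r → ℂ[X]) : Prop where
  rank_eq : G.rank = r
  monic_num : ∀ i, (α i).Monic
  monic_den : ∀ i, (β i).Monic
  coprime : ∀ i, IsCoprime (α i) (β i)
  num_dvd : ∀ i j, i ≤ j → α i ∣ α j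
  den_dvd : ∀ i j, i ≤ j → β j ∣ β i
  equivalent : ∃ (U : Matrix (Fin p) (Fin p) ℂ[X]) (V : Matrix (Fin q) (Fin q) ℂ[X]),
    IsUnit U ∧ IsUnit V ∧
      U.map (algebraMap ℂ[X] (RatFunc ℂ)) * G * V.map (algebraMap ℂ[X] (RatFunc ℂ)) =
        pseudoDiag p q α β

/-- `s₀` is a pole of `G`: a root of one of the denominators of the (unique) Smith–McMillan form
of `G`. -/
def IsPole {p q : ℕ} (G : Matrix (Fin p) (Fin q) (RatFunc ℂ)) (s₀ : ℂ) : Prop :=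
  ∃ (r : ℕ) (α β : Fin r → ℂ[X]), IsSmithMcMillanForm G α β ∧ ∃ i, (β i).IsRoot s₀

/-- `s₀` is a transmission zero of `G`: a root of one of the numerators of the (unique)
Smith–McMillan form of `G`. -/
def IsTransmissionZero {p q : ℕ} (G : Matrix (Fin p) (Fin q) (RatFunc ℂ)) (s₀ : ℂ) : Prop :=
  ∃ (r : ℕ) (α β : Fin r → ℂ[X]), IsSmithMcMillanForm G α β ∧ ∃ i, (α i).IsRoot s₀

/-! Write `~` for the transpose combined with `s ↦ -s` and conjugated coefficients. The relations
among the system matrices force `J G~ J G = 1` (`stateSpaceTransfer_paraConj_mul_self`), so `G` is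
invertible with inverse `J G~ J`. Applying `~` to `U G V = diag(α/β)` diagonalises `G~`; inverting
then diagonalises `G` itself, by unimodular matrices, with entries `β~/α~`. Reversing their order
restores the divisibility chains, and signs make the entries monic. So numerators and denominators
swap while roots move by `s ↦ -s*` (`IsSmithMcMillanForm.paraConj_swap`). Uniqueness of the form is
never needed. -/

/-- The involution `p(s) ↦ p^#(-s)` of `ℂ[s]`, where `p^#` has the conjugate coefficients. -/
noncomputable def paraConj : ℂ[X] →+* ℂ[X] :=
  (Polynomial.compRingHom (-X)).comp (Polynomial.mapRingHom (starRingEnd ℂ))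

theorem paraConj_apply (p : ℂ[X]) : paraConj p = (p.map (starRingEnd ℂ)).comp (-X) := rfl

theorem paraConj_C (a : ℂ) : paraConj (C a) = C (star a) := by
  simp [paraConj_apply]

theorem paraConj_X : paraConj X = -X := by
  simp [paraConj_apply]

theorem paraConj_paraConj (p : ℂ[X]) : paraConj (paraConj p) = p := by
  have h : paraConj.comp paraConj = RingHom.id ℂ[X] := by
    ext
    · simp [paraConj_C]
    · simp [paraConj_X]
  exact congrArg (fun f : ℂ[X] →+* ℂ[X] => f p) h

theorem paraConj_injective : Function.Injective paraConj :=
  Function.LeftInverse.injective paraConj_paraConj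

theorem eval_paraConj (p : ℂ[X]) (s : ℂ) :
    (paraConj p).eval (-(star s)) = star (p.eval s) := by
  rw [paraConj_apply, eval_comp]
  simp only [eval_neg, eval_X, neg_neg]
  rw [← starRingEnd_apply, eval_map_apply, starRingEnd_apply]

/-- The monic associate of `paraConj p`, for monic `p`. -/
noncomputable def monicParaConj (p : ℂ[X]) : ℂ[X] :=
  C ((-1) ^ p.natDegree) * paraConj p

theorem monicParaConj_monic {p : ℂ[X]} (hp : p.Monic) : (monicParaConj p).Monic := by
  have h1 : (p.map (starRingEnd ℂ)).Monic := hp.map _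
  rw [Monic, monicParaConj, leadingCoeff_mul, leadingCoeff_C, paraConj_apply,
    leadingCoeff_comp (by simp), h1.leadingCoeff, natDegree_map]
  simp [← mul_pow]

theorem associated_monicParaConj (p : ℂ[X]) : Associated (paraConj p) (monicParaConj p) := by
  have h : IsUnit (C ((-1 : ℂ) ^ p.natDegree)) :=
    Polynomial.isUnit_C.2 ((isUnit_neg_one).pow _)
  exact (associated_isUnit_mul_left_iff h).2 (Associated.refl _) |>.symm

theorem paraConj_eq_mul_monicParaConj (p : ℂ[X]) :
    paraConj p = C ((-1) ^ p.natDegree) * monicParaConj p := by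
  rw [monicParaConj, ← mul_assoc, ← C_mul, ← mul_pow]
  simp

theorem monicParaConj_dvd {p q : ℂ[X]} (h : p ∣ q) : monicParaConj p ∣ monicParaConj q :=
  ((associated_monicParaConj p).dvd_iff_dvd_left).1
    (((associated_monicParaConj q).dvd_iff_dvd_right).1 (map_dvd paraConj h))

theorem monicParaConj_isCoprime {p q : ℂ[X]} (h : IsCoprime p q) :
    IsCoprime (monicParaConj p) (monicParaConj q) := by
  have h1 : ∀ r : ℂ[X], IsUnit (C ((-1 : ℂ) ^ r.natDegree)) := fun r =>
    Polynomial.isUnit_C.2 ((isUnit_neg_one).pow _)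
  exact (isCoprime_mul_unit_left_left (h1 p) _ _).2
    ((isCoprime_mul_unit_left_right (h1 q) _ _).2 (h.map paraConj))

theorem monicParaConj_isRoot {p : ℂ[X]} {s : ℂ} (h : p.IsRoot s) :
    (monicParaConj p).IsRoot (-(star s)) := by
  rw [IsRoot, monicParaConj, eval_mul, eval_paraConj, h.eq_zero, star_zero, mul_zero]

/-- The extension of `paraConj` to rational functions. -/
noncomputable def ratParaConj : RatFunc ℂ →+* RatFunc ℂ :=
  IsFractionRing.map (A := ℂ[X]) (K := RatFunc ℂ) paraConj_injective

theorem ratParaConj_algebraMap (p : ℂ[X]) :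
    ratParaConj (algebraMap ℂ[X] (RatFunc ℂ) p) = algebraMap ℂ[X] (RatFunc ℂ) (paraConj p) :=
  IsLocalization.map_eq (S := RatFunc ℂ) (Q := RatFunc ℂ)
    (nonZeroDivisors_le_comap_nonZeroDivisors_of_injective _ paraConj_injective) p

theorem ratParaConj_C (a : ℂ) : ratParaConj (RatFunc.C a) = RatFunc.C (star a) := by
  rw [← RatFunc.algebraMap_C, ratParaConj_algebraMap, paraConj_C, RatFunc.algebraMap_C]

theorem ratParaConj_X : ratParaConj RatFunc.X = -RatFunc.X := by
  rw [← RatFunc.algebraMap_X, ratParaConj_algebraMap, paraConj_X, map_neg, RatFunc.algebraMap_X]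

/-! ### Smith–McMillan forms under para-conjugation -/

theorem pseudoDiag_eq_diagonal {N : ℕ} (α β : Fin N → ℂ[X]) :
    pseudoDiag N N α β = Matrix.diagonal fun i =>
      algebraMap ℂ[X] (RatFunc ℂ) (α i) / algebraMap ℂ[X] (RatFunc ℂ) (β i) := by
  ext i j
  by_cases h : i = j
  · subst h
    simp [pseudoDiag]
  · have h' : ¬ (i : ℕ) = (j : ℕ) := fun e => h (Fin.ext e)
    simp [pseudoDiag, h, h']

theorem map_C_eq_map_algebraMap {ι κ : Type*} (M : Matrix ι κ ℂ) :
    M.map RatFunc.C = (M.map (C : ℂ →+* ℂ[X])).map (algebraMap ℂ[X] (RatFunc ℂ)) := by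
  ext i j
  simp [RatFunc.algebraMap_C]

theorem isUnit_matrix_map {ι R S : Type*} [Fintype ι] [DecidableEq ι] [CommRing R] [CommRing S]
    (f : R →+* S) {M : Matrix ι ι R} (h : IsUnit M) : IsUnit (M.map f) :=
  h.map f.mapMatrix

/-- If `K G^#(-s)ᵀ K` inverts `G`, a Smith–McMillan form of `G` yields, on exchanging numerators
and denominators, another one. -/
theorem IsSmithMcMillanForm.paraConj_swap {N : ℕ} {G : Matrix (Fin N) (Fin N) (RatFunc ℂ)}
    {K : Matrix (Fin N) (Fin N) ℂ} (hK : K * K = 1)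
    (hG : K.map RatFunc.C * (G.map ratParaConj)ᵀ * K.map RatFunc.C * G = 1)
    {α β : Fin N → ℂ[X]} (h : IsSmithMcMillanForm G α β) :
    IsSmithMcMillanForm G (fun i => monicParaConj (β i.rev))
      (fun i => monicParaConj (α i.rev)) := by
  refine ⟨h.rank_eq, fun i => monicParaConj_monic (h.monic_den _),
    fun i => monicParaConj_monic (h.monic_num _),
    fun i => (monicParaConj_isCoprime (h.coprime _)).symm,
    fun i j hij => monicParaConj_dvd (h.den_dvd _ _ (Fin.rev_le_rev.2 hij)),
    fun i j hij => monicParaConj_dvd (h.num_dvd _ _ (Fin.rev_le_rev.2 hij)), ?_⟩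
  obtain ⟨U, V, hU, hV, hUV⟩ := h.equivalent
  set φ := algebraMap ℂ[X] (RatFunc ℂ) with hφ
  have hUt : IsUnit (U.map paraConj)ᵀ :=
    (Matrix.isUnit_transpose _).2 (isUnit_matrix_map paraConj hU)
  have hVt : IsUnit (V.map paraConj)ᵀ :=
    (Matrix.isUnit_transpose _).2 (isUnit_matrix_map paraConj hV)
  obtain ⟨U₁, hU₁⟩ := hUt
  obtain ⟨V₁, hV₁⟩ := hVt
  set Kp : Matrix (Fin N) (Fin N) ℂ[X] := K.map (C : ℂ →+* ℂ[X]) with hKp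
  have hKK : Kp * Kp = 1 := by
    rw [hKp, ← Matrix.map_mul, hK]; simp
  have hKu : IsUnit Kp := IsUnit.of_mul_eq_one _ hKK
  -- Constant signs that turn `paraConj (β i) / paraConj (α i)` into a quotient of monic
  -- polynomials.
  set T : Matrix (Fin N) (Fin N) ℂ[X] := Matrix.diagonal fun i =>
    C ((-1) ^ ((α i).natDegree + (β i).natDegree)) with hT
  have hTu : IsUnit T := by
    refine IsUnit.of_mul_eq_one T ?_
    rw [hT, Matrix.diagonal_mul_diagonal]
    simp [← mul_pow]
  set L : Matrix (Fin N) (Fin N) ℂ[X] := T * ((U₁⁻¹).val * Kp) with hL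
  set R : Matrix (Fin N) (Fin N) ℂ[X] := Kp * (V₁⁻¹).val with hR
  have hLu : IsUnit L := hTu.mul (U₁⁻¹.isUnit.mul hKu)
  have hRu : IsUnit R := hKu.mul V₁⁻¹.isUnit
  -- Inverting the diagonal reverses both divisibility chains, so the rows of `L` and the columns of
  -- `R` are permuted back.
  refine ⟨L.submatrix Fin.revPerm (Equiv.refl _), R.submatrix (Equiv.refl _) Fin.revPerm,
    (Matrix.isUnit_submatrix_equiv _ _).2 hLu, (Matrix.isUnit_submatrix_equiv _ _).2 hRu, ?_⟩
  have hmain : ((U₁⁻¹).val * Kp).map φ * G * R.map φ = Matrix.diagonal fun i =>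
      φ (paraConj (β i)) / φ (paraConj (α i)) := by
    have hN : V₁.val.map φ * (G.map ratParaConj)ᵀ * U₁.val.map φ = Matrix.diagonal fun i =>
        φ (paraConj (α i)) / φ (paraConj (β i)) := by
      have e := congrArg (fun M : Matrix (Fin N) (Fin N) (RatFunc ℂ) => (M.map ratParaConj)ᵀ) hUV
      simp only [Matrix.map_mul, Matrix.transpose_mul, pseudoDiag_eq_diagonal] at e
      rw [Matrix.diagonal_map (map_zero _), Matrix.diagonal_transpose] at e
      have hmap : ∀ M : Matrix (Fin N) (Fin N) ℂ[X],
          ((M.map φ).map ratParaConj)ᵀ = (M.map paraConj)ᵀ.map φ := by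
        intro M
        ext i j
        simp [hφ, ratParaConj_algebraMap]
      rw [hmap, hmap, ← hU₁, ← hV₁] at e
      rw [mul_assoc, e]
      simp only [map_div₀, hφ, ratParaConj_algebraMap]
    have hKφ : Kp.map φ = K.map RatFunc.C := (map_C_eq_map_algebraMap K).symm
    have hKK' : Kp.map φ * Kp.map φ = 1 := by
      rw [← Matrix.map_mul, hKK]; simp
    rw [← hKφ] at hG
    have hUφ : U₁.val.map φ * (U₁⁻¹).val.map φ = 1 := by
      rw [← Matrix.map_mul, U₁.mul_inv]; simp
    have hVφ : V₁.val.map φ * (V₁⁻¹).val.map φ = 1 := by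
      rw [← Matrix.map_mul, V₁.mul_inv]; simp
    have hG' : (G.map ratParaConj)ᵀ * Kp.map φ * G = Kp.map φ := by
      calc _ = (Kp.map φ * Kp.map φ) * (G.map ratParaConj)ᵀ * Kp.map φ * G := by
            rw [hKK', one_mul]
        _ = Kp.map φ * (Kp.map φ * (G.map ratParaConj)ᵀ * Kp.map φ * G) := by
            simp only [mul_assoc]
        _ = Kp.map φ := by rw [hG, mul_one]
    have hone : (Matrix.diagonal fun i => φ (paraConj (α i)) / φ (paraConj (β i))) *
        (((U₁⁻¹).val * Kp).map φ * G * R.map φ) = 1 := by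
      rw [← hN, hR, Matrix.map_mul, Matrix.map_mul]
      calc _ = V₁.val.map φ * ((G.map ratParaConj)ᵀ * (U₁.val.map φ * (U₁⁻¹).val.map φ) *
              Kp.map φ * G) * Kp.map φ * (V₁⁻¹).val.map φ := by simp only [mul_assoc]
        _ = V₁.val.map φ * (Kp.map φ * Kp.map φ) * (V₁⁻¹).val.map φ := by
            rw [hUφ, mul_one, hG']; simp only [mul_assoc]
        _ = 1 := by rw [hKK', mul_one, hVφ]
    have hne : ∀ {p : ℂ[X]}, p.Monic → φ (paraConj p) ≠ 0 := fun hp =>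
      (map_ne_zero_iff _ (IsFractionRing.injective ℂ[X] (RatFunc ℂ))).2
        ((map_ne_zero_iff _ paraConj_injective).2 hp.ne_zero)
    have hinv : (Matrix.diagonal fun i => φ (paraConj (β i)) / φ (paraConj (α i))) *
        (Matrix.diagonal fun i => φ (paraConj (α i)) / φ (paraConj (β i))) = 1 := by
      rw [Matrix.diagonal_mul_diagonal, ← Matrix.diagonal_one]
      congr 1
      funext i
      have h1 := hne (h.monic_num i)
      have h2 := hne (h.monic_den i)
      field_simp
    exact (left_inv_eq_right_inv hinv hone).symm
  have hsub : (L.submatrix Fin.revPerm (Equiv.refl _)).map φ * G *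
      (R.submatrix (Equiv.refl _) Fin.revPerm).map φ =
        (L.map φ * G * R.map φ).submatrix Fin.revPerm Fin.revPerm := by
    ext i j
    simp [Matrix.mul_apply]
  rw [hsub, hL, Matrix.map_mul, mul_assoc, mul_assoc, ← mul_assoc _ G, hmain,
    pseudoDiag_eq_diagonal, hT, Matrix.diagonal_map (map_zero _), Matrix.diagonal_mul_diagonal,
    Matrix.submatrix_diagonal_equiv]
  congr 1
  funext i
  -- A sign is its own inverse, so it may pass from numerator to denominator.
  have hsgn : ∀ k : ℕ, φ (C ((-1) ^ k)) * φ (C ((-1) ^ k)) = 1 := fun k => by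
    rw [← map_mul, ← C_mul, ← mul_pow]; simp
  simp only [Function.comp_apply, Fin.revPerm_apply, monicParaConj, map_mul, pow_add]
  rw [mul_div_mul_comm, ← hφ, mul_comm (φ (C ((-1) ^ (α i.rev).natDegree))),
    div_eq_mul_inv (φ (C ((-1) ^ (β i.rev).natDegree))),
    ← eq_inv_of_mul_eq_one_left (hsgn (α i.rev).natDegree)]
  
/-- Invertibility gives full normal rank: the form has no trailing zeros and its diagonal can be
inverted. -/
theorem IsSmithMcMillanForm.size_eq_of_mul_eq_one {N r : ℕ}
    {G H : Matrix (Fin N) (Fin N) (RatFunc ℂ)} (hG : H * G = 1)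
    {α β : Fin r → ℂ[X]} (h : IsSmithMcMillanForm G α β) : r = N := by
  rw [← h.rank_eq, Matrix.rank_of_isUnit _ (IsUnit.of_mul_eq_one_right _ hG), Fintype.card_fin]

theorem isPole_iff_isTransmissionZero_of_paraConj {N : ℕ}
    {G : Matrix (Fin N) (Fin N) (RatFunc ℂ)} {K : Matrix (Fin N) (Fin N) ℂ} (hK : K * K = 1)
    (hG : K.map RatFunc.C * (G.map ratParaConj)ᵀ * K.map RatFunc.C * G = 1) (s : ℂ) :
    IsPole G s ↔ IsTransmissionZero G (-(star s)) := by
  constructor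
  · rintro ⟨r, α, β, h, i, hi⟩
    obtain rfl := h.size_eq_of_mul_eq_one hG
    refine ⟨_, _, _, h.paraConj_swap hK hG, i.rev, ?_⟩
    simpa using monicParaConj_isRoot hi
  · rintro ⟨r, α, β, h, i, hi⟩
    obtain rfl := h.size_eq_of_mul_eq_one hG
    refine ⟨_, _, _, h.paraConj_swap hK hG, i.rev, ?_⟩
    simpa using monicParaConj_isRoot hi

/-! ### Para-unitarity of the state-space transfer matrix -/

theorem Jmat_mul_Jmat (k : ℕ) : Jmat k * Jmat k = 1 := by
  simp [Jmat, Matrix.fromBlocks_multiply]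

theorem conjTranspose_Jmat (k : ℕ) : (Jmat k)ᴴ = Jmat k := by
  simp [Jmat, Matrix.fromBlocks_conjTranspose]

theorem map_ratParaConj_map_C {ι κ : Type*} (M : Matrix ι κ ℂ) :
    ((M.map RatFunc.C).map ratParaConj)ᵀ = Mᴴ.map RatFunc.C := by
  ext i j
  simp [ratParaConj_C]

/-- The determinant is the image of the characteristic polynomial, which is monic. -/
theorem isUnit_scalar_X_sub_map {σ : Type} [Fintype σ] [DecidableEq σ] (A : Matrix σ σ ℂ) :
    IsUnit (Matrix.scalar σ (RatFunc.X : RatFunc ℂ) - A.map RatFunc.C) := by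
  have h : Matrix.scalar σ (RatFunc.X : RatFunc ℂ) - A.map RatFunc.C =
      A.charmatrix.map (algebraMap ℂ[X] (RatFunc ℂ)) := by
    ext i j
    by_cases e : i = j <;> simp [Matrix.charmatrix, e, RatFunc.algebraMap_C, RatFunc.algebraMap_X]
  rw [h, Matrix.isUnit_iff_isUnit_det, ← RingHom.mapMatrix_apply, ← RingHom.map_det,
    isUnit_iff_ne_zero]
  exact (map_ne_zero_iff _ (IsFractionRing.injective ℂ[X] (RatFunc ℂ))).2
    A.charpoly_monic.ne_zero

/-- A state-space system with `A + A^♭ + C^♭ C = 0`, `B = -C^♭ D` and `D^♭ D = 1`, where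
`X^♭ = J X^† K`, has a transfer matrix which is `(J, K)`-unitary on the imaginary axis. -/
theorem stateSpaceTransfer_paraConj_mul_self {σ ι : Type} [Fintype σ] [DecidableEq σ] [Fintype ι]
    [DecidableEq ι] {J A : Matrix σ σ ℂ} {K D : Matrix ι ι ℂ} {B : Matrix σ ι ℂ}
    {C : Matrix ι σ ℂ} (hJ : J * J = 1) (hJh : Jᴴ = J) (hKh : Kᴴ = K)
    (hA : A + J * Aᴴ * J + J * Cᴴ * K * C = 0) (hB : B = -(J * Cᴴ * K * D))
    (hD : K * Dᴴ * K * D = 1) :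
    K.map RatFunc.C * ((stateSpaceTransfer A B C D).map ratParaConj)ᵀ * K.map RatFunc.C *
      stateSpaceTransfer A B C D = 1 := by
  have hP := isUnit_scalar_X_sub_map A
  have hP' : (Matrix.scalar σ (RatFunc.X : RatFunc ℂ) - A.map RatFunc.C) *
      (Matrix.scalar σ (RatFunc.X : RatFunc ℂ) - A.map RatFunc.C)⁻¹ = 1 :=
    Matrix.mul_nonsing_inv _ ((Matrix.isUnit_iff_isUnit_det _).1 hP)
  unfold stateSpaceTransfer
  set P := Matrix.scalar σ (RatFunc.X : RatFunc ℂ) - A.map RatFunc.C with hPdef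
  set R := P⁻¹
  set φ : ℂ →+* RatFunc ℂ := RatFunc.C with hφ
  set Rt := (R.map ratParaConj)ᵀ with hRt
  set Pt := (P.map ratParaConj)ᵀ with hPt
  have hRPt : Rt * Pt = 1 := by
    rw [hRt, hPt, ← Matrix.transpose_mul, ← Matrix.map_mul, hP']; simp
  have hPtval : Pt = -Matrix.scalar σ (RatFunc.X : RatFunc ℂ) - Aᴴ.map φ := by
    ext i j
    by_cases e : j = i
    · subst e; simp [hPt, hPdef, hφ, ratParaConj_C, ratParaConj_X]
    · simp [hPt, hPdef, hφ, ratParaConj_C, e, Ne.symm e]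
  have hJφ : J.map φ * J.map φ = 1 := by rw [← Matrix.map_mul, hJ]; simp
  have hDφ : K.map φ * Dᴴ.map φ * K.map φ * D.map φ = 1 := by
    simp only [← Matrix.map_mul, hD]; simp
  have hBh : Bᴴ = -(Dᴴ * K * C * J) := by
    simp [hB, Matrix.conjTranspose_mul, hJh, hKh, Matrix.mul_assoc]
  -- The terms in `s` cancel because `~` sends `s` to `-s`; what remains is `hA`.
  have hsum : P + J.map φ * Pt * J.map φ =
      J.map φ * Cᴴ.map φ * K.map φ * C.map φ := by
    have e := congrArg (fun M : Matrix σ σ ℂ => M.map φ) hA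
    simp only [Matrix.map_add φ (map_add φ), Matrix.map_mul, Matrix.map_zero φ (map_zero φ)] at e
    have hcomm : J.map φ * Matrix.scalar σ (RatFunc.X : RatFunc ℂ) * J.map φ =
        Matrix.scalar σ RatFunc.X := by
      rw [← (Matrix.scalar_commute _ (fun _ => Commute.all _ _) _).eq, mul_assoc, hJφ, mul_one]
    rw [hPtval, mul_sub, sub_mul, mul_neg, neg_mul, hcomm, hPdef, ← sub_eq_zero, ← neg_eq_zero,
      ← e]
    abel
  have hG : ((C.map φ * R * B.map φ + D.map φ).map ratParaConj)ᵀ =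
      Bᴴ.map φ * Rt * Cᴴ.map φ + Dᴴ.map φ := by
    rw [Matrix.map_add _ (map_add _), Matrix.transpose_add, Matrix.map_mul, Matrix.map_mul,
      Matrix.transpose_mul, Matrix.transpose_mul, map_ratParaConj_map_C, map_ratParaConj_map_C,
      map_ratParaConj_map_C, Matrix.mul_assoc]
  have hneg : ∀ {ι κ : Type} (M : Matrix ι κ ℂ), (-M).map φ = -(M.map φ) := fun M => by
    ext i j; simp
  rw [hG, hBh, hB, hneg, hneg]
  simp only [Matrix.map_mul]
  generalize C.map φ = c at *
  generalize Cᴴ.map φ = c' at *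
  generalize D.map φ = d at *
  generalize Dᴴ.map φ = d' at *
  generalize J.map φ = j at *
  generalize K.map φ = k at *
  have hleft : k * (-(d' * k * c * j) * Rt * c' + d') * k =
      k * d' * k * (1 - c * (j * Rt * c' * k)) := by
    simp only [mul_add, add_mul, mul_sub, mul_one, mul_neg, neg_mul, Matrix.neg_mul, Matrix.mul_assoc]
    abel
  have hright : c * R * -(j * c' * k * d) + d = (1 - c * (R * (j * c' * k))) * d := by
    simp only [Matrix.sub_mul, Matrix.one_mul, Matrix.mul_neg, Matrix.mul_assoc]
    abel
  have hmid : (1 - c * (j * Rt * c' * k)) * (1 - c * (R * (j * c' * k))) = 1 := by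
    -- As in the resolvent identity: by `hsum` the inner factor `j c' k c` is `P + j Pt j`, whose
    -- summands cancel `R` and `Rt` respectively. The result is exactly the sum of the linear terms
    -- of `hmid`.
    have e : (j * Rt * c' * k) * (c * (R * (j * c' * k))) =
        j * Rt * c' * k + R * (j * c' * k) := by
      have hjj : ∀ {τ : Type} (M : Matrix σ τ (RatFunc ℂ)), j * (j * M) = M := fun M => by
        rw [← Matrix.mul_assoc, hJφ, Matrix.one_mul]
      calc _ = j * Rt * j * (j * c' * k * c) * R * (j * c' * k) := by
            simp only [Matrix.mul_assoc, hjj]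
        _ = j * Rt * j * (P * R) * (j * c' * k) + j * (Rt * Pt) * j * R * (j * c' * k) := by
            rw [← hsum]
            simp only [Matrix.mul_add, Matrix.add_mul, Matrix.mul_assoc, hjj]
        _ = _ := by
            rw [hP', hRPt]
            simp only [Matrix.mul_one, Matrix.mul_assoc, hjj]
    rw [Matrix.sub_mul, Matrix.one_mul, Matrix.mul_sub, Matrix.mul_one,
      Matrix.mul_assoc c (j * Rt * c' * k), e, Matrix.mul_add]
    abel
  rw [hleft, hright, mul_assoc, ← mul_assoc _ _ d, hmid, one_mul, hDφ]

/-! ### The linear quantum system -/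

theorem LinearQuantumSystem.Dmat_flat_mul_self {n m : ℕ} (Q : LinearQuantumSystem n m) :
    Jmat m * Q.Dmatᴴ * Jmat m * Q.Dmat = 1 := by
  have h : Q.Sᴴ * Q.S = 1 := Matrix.mem_unitaryGroup_iff'.1 Q.unitary_S
  have h' : (Q.S.map star)ᴴ * Q.S.map star = 1 := by
    have e := congrArg (fun M : Matrix (Fin m) (Fin m) ℂ => M.map (starRingEnd ℂ)) h
    simp only [Matrix.map_mul] at e
    rw [Matrix.map_one _ (map_zero _) (map_one _)] at e
    exact e
  have hD : Q.Dmat = Matrix.fromBlocks Q.S 0 0 (Q.S.map star) := by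
    rw [Dmat, doubledUp, Matrix.map_zero _ (star_zero ℂ)]
  rw [hD, Jmat, Matrix.fromBlocks_conjTranspose]
  simp only [Matrix.fromBlocks_multiply, Matrix.conjTranspose_zero, Matrix.one_mul, Matrix.mul_one,
    Matrix.zero_mul, Matrix.mul_zero, Matrix.neg_mul, Matrix.mul_neg, neg_neg, neg_zero, add_zero,
    zero_add, h, h', Matrix.fromBlocks_one]

/-- Since `Ω` is Hermitian, `-i J Ω` is skew for `♭` and drops out; `-(1/2) 𝒞^♭ 𝒞` is
`♭`-self-adjoint and counts twice. -/
theorem LinearQuantumSystem.Amat_add_flat {n m : ℕ} (Q : LinearQuantumSystem n m) :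
    Q.Amat + Jmat n * Q.Amatᴴ * Jmat n + Jmat n * Q.Cmatᴴ * Jmat m * Q.Cmat = 0 := by
  have hΩ : Q.Ωmatᴴ = Q.Ωmat := Q.hermitian_Ω
  have hJ := Jmat_mul_Jmat n
  have hI : star Complex.I = -Complex.I := Complex.conj_I
  have hhalf : star (1 / 2 : ℂ) = 1 / 2 := by simp
  have hAh : Q.Amatᴴ = Complex.I • (Q.Ωmat * Jmat n) -
      (1 / 2 : ℂ) • (Q.Cmatᴴ * Jmat m * Q.Cmat * Jmat n) := by
    simp only [Amat, flatAdj, Matrix.conjTranspose_sub, Matrix.conjTranspose_neg,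
      Matrix.conjTranspose_smul, Matrix.conjTranspose_mul, Matrix.conjTranspose_conjTranspose,
      conjTranspose_Jmat, hΩ, hI, hhalf, neg_smul, neg_neg, Matrix.mul_assoc]
  have hJA : Jmat n * Q.Amatᴴ * Jmat n = Complex.I • (Jmat n * Q.Ωmat) -
      (1 / 2 : ℂ) • (Jmat n * Q.Cmatᴴ * Jmat m * Q.Cmat) := by
    rw [hAh]
    simp only [Matrix.mul_sub, Matrix.sub_mul, Matrix.mul_smul, Matrix.smul_mul, Matrix.mul_assoc,
      hJ, Matrix.mul_one]
  rw [hJA, Amat, flatAdj]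
  module

theorem LinearQuantumSystem.transferMatrix_paraConj_mul_self {n m : ℕ}
    (Q : LinearQuantumSystem n m) :
    (Matrix.reindex finSumFinEquiv finSumFinEquiv (Jmat m)).map RatFunc.C *
      (Q.transferMatrix.map ratParaConj)ᵀ *
      (Matrix.reindex finSumFinEquiv finSumFinEquiv (Jmat m)).map RatFunc.C *
      Q.transferMatrix = 1 := by
  have h := stateSpaceTransfer_paraConj_mul_self (B := Q.Bmat) (Jmat_mul_Jmat n)
    (conjTranspose_Jmat n) (conjTranspose_Jmat m) Q.Amat_add_flat rfl
    Q.Dmat_flat_mul_self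
  have h' := congrArg (Matrix.reindex finSumFinEquiv finSumFinEquiv) h
  simp only [Matrix.reindex_apply, Matrix.submatrix_one_equiv] at h'
  rw [← Matrix.submatrix_mul_equiv _ _ _ finSumFinEquiv.symm,
    ← Matrix.submatrix_mul_equiv _ _ _ finSumFinEquiv.symm,
    ← Matrix.submatrix_mul_equiv _ _ _ finSumFinEquiv.symm] at h'
  exact h'

theorem proposition1 {n m : ℕ} (Q : LinearQuantumSystem n m) (s₀ : ℂ) :
    IsPole Q.transferMatrix s₀ ↔ IsTransmissionZero Q.transferMatrix (-(star s₀)) := by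
  refine isPole_iff_isTransmissionZero_of_paraConj
    (K := Matrix.reindex finSumFinEquiv finSumFinEquiv (Jmat m)) ?_
    Q.transferMatrix_paraConj_mul_self s₀
  simp [Matrix.submatrix_mul_equiv, Jmat_mul_Jmat]
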